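/- **Theorem.** A virtual knot diagram $D$ is considered up to detour moves, i.e. as an oriented Gauss diagram: one oriented core circle, and for every (classical) crossing a signed chord directed from the over- to the under-passage. Equivalently, $D$ is a 4-valent graph with a cyclic order of the half-edges at each crossing. Thickening the graph to an oriented band surface and pasting a disc to each boundary component gives a closed connected oriented surface $S(D)$, the underlying surface of $D$; its genus is the genus of $D$. The boundary components of the band surface are called the pasted cycles of $D$. $H_1(S(D);\mathbb Z_2)$ is computed from the cell structure of $S(D)$ given by the crossings, the edges and the pasted discs. The *parity group* $G(D)$ is the abelian group generated by the crossings of $D$ with the relations $2a=0$ for every crossing $a$ and, for every pasted cycle, (the sum of the crossings it visits, counted with multiplicity) $=0$; let $g(a)\in G(D)$ be the element given by the crossing $a$. Smoothing $D$ at a crossing $a$ along the orientation splits the knot into two closed loops, the halves $h_{a,1},h_{a,2}$ of the knot at $a$. Let $[K]\in H_1(S(D);\mathbb Z_2)$ be the class of the knot. 1. For every virtual knot diagram $D$ there is an isomorphism $$G(D)\;\cong\; H_1(S(D);\mathbb Z_2)/\langle [K]\rangle$$ which sends $g(a)$ to the class of $h_{a,1}$ and also to the class of $h_{a,2}$, for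 every crossing $a$. 2. If $D$ is checkerboard colourable (the cells into which $D$ divides $S(D)$ can be 2-coloured so that the two sides of every edge have different colours), then there is an isomorphism $G(D)\cong H_1(S(D);\mathbb Z_2)$ which sends $g(a)$ to the class of $h_{a,1}$ and also to the class of $h_{a,2}$, for every crossing $a$. 3. Let $D_1$ and $D_2$ be non-stably equivalent, i.e. connected by a finite sequence of Reidemeister moves (and isomorphisms of diagrams) in which all diagrams have the same genus. Then $G(D_1)\cong G(D_2)$; more precisely, for each such sequence there is an isomorphism $G(D_1)\to G(D_2)$ which sends $g(x)$ to $g(y)$ whenever the sequence carries the crossing $x$ of $D_1$ over to the crossing $y$ of $D_2$. -/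

import Mathlib

open scoped BigOperators

noncomputable section

/-- An oriented Gauss diagram, i.e. a virtual knot diagram up to detour moves.
A *passage* is a pair `(c, l)` with `c` a classical crossing: the moment at which the knot runs
through `c` on the upper branch (`l = true`) or on the lower branch (`l = false`).  The chord of
`c` points from `(c, true)` to `(c, false)`.  `next` sends a passage to the following one along
the oriented core circle.  `sign c = true` means that `c` is a positive crossing.
The diagram without crossings is the circle (the crossingless diagram of the unknot). -/
structure GaussDiagram where
  Crossing : Type
  [fintypeCrossing : Fintype Crossing]
  [decidableEqCrossing : DecidableEq Crossing]
  next : Equiv.Perm (Crossing × Bool)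
  /-- there is only one core circle (one-component diagrams) -/
  exists_pow_next : ∀ p q : Crossing × Bool, ∃ k : ℕ, (next ^ k) p = q
  sign : Crossing → Bool

namespace GaussDiagram

attribute [instance] fintypeCrossing decidableEqCrossing

variable (D : GaussDiagram)

abbrev Passage : Type := D.Crossing × Bool

/-- The edges of the 4-valent graph of `D`.  The edge `p` leads from the passage `p` to the
passage `D.next p`. -/
abbrev Edge : Type := D.Passage

/-- Half-edges: `(p, true)` is the half-edge leaving the crossing at the passage `p` and
`(p, false)` is the half-edge arriving there. -/
abbrev Dart : Type := D.Passage × Bool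

variable {D} in
/-- The crossing at which a half-edge is attached. -/
def vertex (d : D.Dart) : D.Crossing := d.1.1

/-- The edge containing a half-edge. -/
def edge (d : D.Dart) : D.Edge := if d.2 then d.1 else D.next.symm d.1

/-- The other half of the same edge. -/
def opp : Equiv.Perm D.Dart where
  toFun d := if d.2 then (D.next d.1, false) else (D.next.symm d.1, true)
  invFun d := if d.2 then (D.next d.1, false) else (D.next.symm d.1, true)
  left_inv := by rintro ⟨p, _ | _⟩ <;> simp
  right_inv := by rintro ⟨p, _ | _⟩ <;> simp

/-- The counterclockwise rotation of the four half-edges at a crossing.  At a positive crossing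
the counterclockwise order is: over-out, under-out, over-in, under-in; at a negative crossing it
is: over-out, under-in, over-in, under-out. -/
def rot : Equiv.Perm D.Dart where
  toFun d := ((d.1.1, !d.1.2), xor d.2 (xor d.1.2 (D.sign d.1.1)))
  invFun d := ((d.1.1, !d.1.2), xor d.2 (xor (!d.1.2) (D.sign d.1.1)))
  left_inv := by rintro ⟨⟨c, l⟩, o⟩; cases l <;> cases o <;> cases h : D.sign c <;> simp [h]
  right_inv := by rintro ⟨⟨c, l⟩, o⟩; cases l <;> cases o <;> cases h : D.sign c <;> simp [h]

/-- Walking along the boundary of the ribbon surface: go along the half-edge `d` to the other end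
of its edge, and leave the crossing there by the leftmost half-edge. -/
def facePerm : Equiv.Perm D.Dart := D.opp.trans D.rot.symm

/-- The pasted cycles: the boundary components of the band surface of `D`, which is a
neighbourhood of its 4-valent graph.  A half-edge `d` belongs to the boundary component running
along the left-hand side of the edge of `d`, in the direction of `d`.
Equivalently, these are the 2-cells of the closed oriented surface `S(D)` obtained by gluing a
disc to every boundary component. -/
def Face : Type := Quotient (Equiv.Perm.SameCycle.setoid D.facePerm)

/-- The pasted cycle on the left of a half-edge (directed away from its crossing). -/
def face (d : D.Dart) : D.Face := Quotient.mk (Equiv.Perm.SameCycle.setoid D.facePerm) d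

/-- The Euler characteristic of the underlying surface `S(D)`.  The surface of the crossingless
diagram is an annulus with two discs pasted, that is, a sphere. -/
def eulerChar : ℤ :=
  open Classical in
  if IsEmpty D.Crossing then 2
  else (Nat.card D.Crossing : ℤ) - (Nat.card D.Edge : ℤ) + (Nat.card D.Face : ℤ)

/-- The underlying surface of `D` (closed, connected, oriented) has genus `g`. -/
def HasGenus (g : ℕ) : Prop := D.eulerChar = 2 - 2 * (g : ℤ)

/-! ### The parity group -/

open Classical in
/-- The relators of the parity group: `2a` for every crossing `a`, and for every pasted cycle the
sum of the crossings that it visits (counted as often as they are visited). -/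
def parityRelators : Set (FreeAbelianGroup D.Crossing) :=
  Set.range (fun a : D.Crossing => 2 • FreeAbelianGroup.of a) ∪
    Set.range (fun F : D.Face => ∑ d : D.Dart with D.face d = F, FreeAbelianGroup.of (vertex d))

/-- The parity group `G(D)`. -/
abbrev ParityGroup : Type :=
  FreeAbelianGroup D.Crossing ⧸ AddSubgroup.closure D.parityRelators

/-- The element of `G(D)` given by a crossing. -/
def gen (a : D.Crossing) : D.ParityGroup := QuotientAddGroup.mk (FreeAbelianGroup.of a)

/-! ### The first homology group of the underlying surface

`S(D)` is a cell complex with the crossings as vertices, the edges of the 4-valent graph as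
1-cells and the pasted discs as 2-cells. (For the diagram without crossings the complex is zero,
which gives the right group `H₁(S²; ℤ/2) = 0`.) -/

/-- The cellular boundary operator `C₁ → C₀` with coefficients in `ℤ/2`. -/
def boundary₁ : (D.Edge →₀ ZMod 2) →ₗ[ZMod 2] (D.Crossing →₀ ZMod 2) :=
  Finsupp.linearCombination (ZMod 2)
    fun p : D.Edge => Finsupp.single p.1 1 + Finsupp.single (D.next p).1 1

open Classical in
/-- The boundary of a 2-cell, as a 1-chain. -/
def faceChain (F : D.Face) : D.Edge →₀ ZMod 2 :=
  ∑ d : D.Dart with D.face d = F, Finsupp.single (D.edge d) 1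

theorem face_facePerm (d : D.Dart) : D.face (D.facePerm d) = D.face d :=
  Quotient.sound (s := Equiv.Perm.SameCycle.setoid D.facePerm)
    (show D.facePerm.SameCycle (D.facePerm d) d from (Equiv.Perm.sameCycle_apply_left).2 (.refl _ _))

theorem boundary₁_edge (d : D.Dart) : D.boundary₁ (Finsupp.single (D.edge d) 1) =
    Finsupp.single (vertex d) 1 + Finsupp.single (vertex (D.facePerm d)) 1 := by
  rcases d with ⟨p, _ | _⟩ <;>
    simp [boundary₁, edge, vertex, facePerm, opp, rot, add_comm]

theorem boundary₁_faceChain (F : D.Face) : D.boundary₁ (D.faceChain F) = 0 := by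
  classical
  have key : ∑ d : D.Dart with D.face d = F,
        (Finsupp.single (vertex (D.facePerm d)) 1 : D.Crossing →₀ ZMod 2)
      = ∑ d : D.Dart with D.face d = F, Finsupp.single (vertex d) 1 := by
    refine Finset.sum_equiv D.facePerm (fun d => ?_) (fun d _ => rfl)
    simp [face_facePerm]
  rw [faceChain, map_sum]
  simp only [boundary₁_edge, Finset.sum_add_distrib]
  rw [key]
  exact ZModModule.add_self _

/-- The cellular boundary operator from `C₂` to the 1-cycles. -/
def boundary₂ : (D.Face →₀ ZMod 2) →ₗ[ZMod 2] LinearMap.ker D.boundary₁ :=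
  Finsupp.linearCombination (ZMod 2)
    fun F : D.Face => (⟨D.faceChain F, D.boundary₁_faceChain F⟩ : LinearMap.ker D.boundary₁)

/-- The first homology group `H₁(S(D); ℤ/2)` of the underlying surface. -/
abbrev H₁ : Type := LinearMap.ker D.boundary₁ ⧸ LinearMap.range D.boundary₂

/-- The 1-cycle given by the whole knot. -/
def knotCycle : LinearMap.ker D.boundary₁ :=
  ⟨∑ p : D.Edge, Finsupp.single p 1, by
    rw [LinearMap.mem_ker, map_sum]
    simp only [boundary₁, Finsupp.linearCombination_single, one_smul, Finset.sum_add_distrib]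
    rw [Equiv.sum_comp D.next (fun p => (Finsupp.single p.1 1 : D.Crossing →₀ ZMod 2))]
    exact ZModModule.add_self _⟩

/-- The homology class of the knot. -/
def knotClass : D.H₁ := Submodule.Quotient.mk D.knotCycle

/-- The number of edges that the knot runs through between the passage `p` and the other passage
of the same crossing. -/
def halfLength (p : D.Passage) : ℕ := sInf {k : ℕ | (D.next ^ k) p = (p.1, !p.2)}

theorem next_pow_halfLength (p : D.Passage) :
    (D.next ^ D.halfLength p) p = (p.1, !p.2) :=
  Nat.sInf_mem (s := {k : ℕ | (D.next ^ k) p = (p.1, !p.2)}) (D.exists_pow_next p _)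

theorem boundary₁_path (p : D.Passage) (n : ℕ) :
    D.boundary₁ (∑ k ∈ Finset.range n, Finsupp.single ((D.next ^ k) p) 1) =
      Finsupp.single p.1 1 + Finsupp.single ((D.next ^ n) p).1 1 := by
  induction n with
  | zero => simpa using (ZModModule.add_self (Finsupp.single p.1 (1 : ZMod 2))).symm
  | succ n ih =>
    rw [Finset.sum_range_succ, map_add, ih, pow_succ', Equiv.Perm.mul_apply]
    simp only [boundary₁, Finsupp.linearCombination_single, one_smul]
    rw [add_assoc, ← add_assoc (Finsupp.single ((D.next ^ n) p).1 (1 : ZMod 2)),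
      ZModModule.add_self, zero_add]

/-- A half of the knot at the crossing `p.1`: the loop which leaves that crossing at the passage
`p` and follows the knot until its other passage through the crossing.  The two halves at a
crossing `c` (the components of the oriented smoothing at `c`) are those of `(c, true)` and
`(c, false)`. -/
def halfCycle (p : D.Passage) : LinearMap.ker D.boundary₁ :=
  ⟨∑ k ∈ Finset.range (D.halfLength p), Finsupp.single ((D.next ^ k) p) 1, by
    rw [LinearMap.mem_ker, boundary₁_path, next_pow_halfLength]
    exact ZModModule.add_self _⟩

/-- The homology class of a half of the knot. -/
def halfClass (p : D.Passage) : D.H₁ := Submodule.Quotient.mk (D.halfCycle p)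

/-- `D` is checkerboard colourable: the cells into which the diagram divides `S(D)` can be
coloured with two colours so that the colours on the two sides of every edge differ. -/
def CheckerboardColourable : Prop :=
  ∃ colour : D.Face → Bool, ∀ d : D.Dart, colour (D.face d) ≠ colour (D.face (D.opp d))

/-! ### Reidemeister moves and equivalence without stabilization -/

/-- `D` is obtained from `E` by deleting the chords outside the image of the injection `f`. -/
structure IsDeletion (D E : GaussDiagram) (f : D.Crossing → E.Crossing) : Prop where
  injective : Function.Injective f
  sign_eq : ∀ x, E.sign (f x) = D.sign x
  /-- the next passage in `D` is the first one after it in `E` that is not deleted -/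
  next_eq : ∀ p : D.Passage, ∃ k : ℕ, 0 < k ∧
    (E.next ^ k) (f p.1, p.2) = (f (D.next p).1, (D.next p).2) ∧
    ∀ j : ℕ, 0 < j → j < k → ((E.next ^ j) (f p.1, p.2)).1 ∉ Set.range f

/-- `Move D E f`: the diagram `E` is obtained from `D` by an isomorphism, by a first or second
Reidemeister move that creates crossings, or by a third Reidemeister move; `f` sends every
crossing of `D` to the corresponding crossing of `E`. -/
inductive Move (D E : GaussDiagram) (f : D.Crossing → E.Crossing) : Prop
  /-- an isomorphism of Gauss diagrams -/
  | iso (h : IsDeletion D E f) (hf : Function.Surjective f) : Move D E f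
  /-- an isolated chord `a`, of any sign and direction, is added -/
  | reidemeister₁ (h : IsDeletion D E f) (a : E.Crossing) (ha : Set.range f = {a}ᶜ)
      (l : Bool) (hl : E.next (a, l) = (a, !l)) : Move D E f
  /-- two chords `a`, `b` of the same direction and of opposite signs are added, such that their
  tails are adjacent on the core circle and their heads are adjacent -/
  | reidemeister₂ (h : IsDeletion D E f) (a b : E.Crossing) (hab : a ≠ b)
      (hr : Set.range f = {a, b}ᶜ) (hs : E.sign a ≠ E.sign b)
      (ho : E.next (a, true) = (b, true))
      (hu : E.next (a, false) = (b, false) ∨ E.next (b, false) = (a, false)) : Move D E f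
  /-- The three edges `t`, `m`, `b` of `D` bound a triangular pasted cycle; the upper branch of
  the knot contains `t` and passes over the two others at the crossings `x` and `y`, and the
  middle branch contains `m` and passes over the lower branch, which contains `b`, at `z`.
  The move exchanges the two ends of each of the three edges on the core circle. -/
  | reidemeister₃ (x y z : D.Crossing) (hxy : x ≠ y) (hxz : x ≠ z) (hyz : y ≠ z)
      (t m b : D.Edge)
      (ht : s(t, D.next t) = s((x, true), (y, true)))
      (hm : s(m, D.next m) = s((x, false), (z, true)))
      (hb : s(b, D.next b) = s((y, false), (z, false)))
      (d : D.Dart) (hd : D.facePerm (D.facePerm (D.facePerm d)) = d)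
      (hd' : ({D.edge d, D.edge (D.facePerm d), D.edge (D.facePerm (D.facePerm d))} :
        Set D.Edge) = {t, m, b})
      (hf : Function.Bijective f) (hs : ∀ c, E.sign (f c) = D.sign c)
      (τ : Equiv.Perm D.Passage)
      (hτ : τ = Equiv.swap (x, true) (y, true) * Equiv.swap (x, false) (z, true) *
        Equiv.swap (y, false) (z, false))
      (hn : ∀ p : D.Passage,
        E.next (f (τ p).1, (τ p).2) = (f (τ (D.next p)).1, (τ (D.next p)).2)) : Move D E f

/-- `NonstablyEquivalent g D E R`: the diagram `E` is obtained from `D` by a sequence of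
isomorphisms and Reidemeister moves in both directions such that all diagrams of the sequence
have underlying surfaces of genus `g` (no stabilization or destabilization takes place).
`R x y` says that the sequence carries the crossing `x` of `D` over to the crossing `y` of `E`. -/
inductive NonstablyEquivalent (g : ℕ) (D : GaussDiagram) :
    (E : GaussDiagram) → (D.Crossing → E.Crossing → Prop) → Prop
  | refl (h : D.HasGenus g) : NonstablyEquivalent g D D Eq
  | move {E F : GaussDiagram} {R : D.Crossing → E.Crossing → Prop} (f : E.Crossing → F.Crossing)
      (h : NonstablyEquivalent g D E R) (hm : Move E F f) (hF : F.HasGenus g) :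
      NonstablyEquivalent g D F (fun x z => ∃ y, R x y ∧ f y = z)
  | moveInv {E F : GaussDiagram} {R : D.Crossing → E.Crossing → Prop}
      (f : F.Crossing → E.Crossing)
      (h : NonstablyEquivalent g D E R) (hm : Move F E f) (hF : F.HasGenus g) :
      NonstablyEquivalent g D F (fun x z => R x (f z))

end GaussDiagram

end

open scoped BigOperators

noncomputable section

namespace GaussDiagram

section

variable (D : GaussDiagram)

/-! ### The turning homomorphism -/

/-! Send a 1-cycle mod 2 to the set of crossings at which it turns from one branch to the other
(`turn`). A half at `a` turns only at `a`, so every set of crossings is attained; a cycle that turns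
nowhere has constant coefficients along the core circle, so it is zero or the whole knot. Hence
cycles modulo the knot are the space spanned by the crossings. The boundary of a cell turns at a
crossing according to the parity of the number of corners it has there, so boundaries go to the
relations of the parity group (`faceTurn_single`), and the quotients are isomorphic (`ker_turnH₁`).
A checkerboard colouring exhibits the knot as a boundary, which gives the second claim.

For invariance, a relation is the vector of corner sums of a colouring of the cells
(`mem_relSpace_iff`). For a move from `D` to `E`, a colouring for `E` whose corner sums vanish at
the new crossings is turned into a colouring for `D` with the same remaining sums. So relations of
`E` supported on old crossings are relations of `D`. The converse is replaced by a dimension count: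
by Euler's formula, in genus `g` the parity group of a diagram with crossings has dimension `2g` if
the diagram is checkerboard colourable and `2g - 1` otherwise. Colourability passes from `E` to `D`,
so the group of `E` is not larger, and the map induced on crossings must be an isomorphism
(`exists_equiv_of_comap_le`). -/

theorem boundary₁_apply (z : D.Edge →₀ ZMod 2) (a : D.Crossing) :
    D.boundary₁ z a = z (a, true) + z (a, false) + z (D.next.symm (a, true))
      + z (D.next.symm (a, false)) := by
  induction z using Finsupp.induction_linear with
  | zero => simp
  | add f g hf hg => rw [map_add, Finsupp.add_apply, hf, hg]; simp only [Finsupp.add_apply]; ring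
  | single q r =>
    have h (l : Bool) : (q = D.next.symm (a, l)) ↔ D.next q = (a, l) := Equiv.eq_symm_apply _
    have e (p : D.Passage) : (if p.1 = a then r else 0 : ZMod 2) =
        (if p = (a, true) then r else 0) + (if p = (a, false) then r else 0) := by
      rcases p with ⟨c, _ | _⟩ <;> simp
    simp only [boundary₁, Finsupp.linearCombination_single, Finsupp.smul_apply, Finsupp.add_apply,
      Finsupp.single_apply, smul_add, smul_eq_mul, mul_ite, mul_one, mul_zero, h]
    rw [e q, e (D.next q)]
    ring

/-- The value at `a` tells whether a 1-cycle turns at the crossing `a`. -/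
def turn : (D.Edge →₀ ZMod 2) →ₗ[ZMod 2] (D.Crossing → ZMod 2) :=
  LinearMap.pi fun a => Finsupp.lapply (a, true) + Finsupp.lapply (D.next.symm (a, true))

theorem turn_apply (z : D.Edge →₀ ZMod 2) (a : D.Crossing) :
    D.turn z a = z (a, true) + z (D.next.symm (a, true)) := rfl

/-- Along a path, the coefficients before and after a passage cancel except at the two ends. Here
the ends are the two passages of one crossing, of which exactly one is the upper passage counted by
`turn`. -/
theorem turn_halfCycle (p : D.Passage) : D.turn (D.halfCycle p) = Pi.single p.1 1 := by
  have key (n : ℕ) (q : D.Passage) :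
      (∑ k ∈ Finset.range n, Finsupp.single ((D.next ^ k) p) (1 : ZMod 2)) q +
      (∑ k ∈ Finset.range n, Finsupp.single ((D.next ^ k) p) (1 : ZMod 2)) (D.next.symm q) =
      Finsupp.single p 1 q + Finsupp.single ((D.next ^ n) p) 1 q := by
    induction n with
    | zero => simpa using (ZModModule.add_self (Finsupp.single p (1 : ZMod 2) q)).symm
    | succ n ih =>
      have h : Finsupp.single ((D.next ^ n) p) (1 : ZMod 2) (D.next.symm q) =
          Finsupp.single ((D.next ^ (n + 1)) p) 1 q := by
        simp only [Finsupp.single_apply, pow_succ', Equiv.Perm.mul_apply, Equiv.eq_symm_apply]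
      rw [Finset.sum_range_succ, Finsupp.add_apply, Finsupp.add_apply, h]
      linear_combination ih + ZModModule.add_self (Finsupp.single ((D.next ^ n) p) (1 : ZMod 2) q)
  ext a
  rw [turn_apply]
  refine (key _ _).trans ?_
  rw [next_pow_halfLength]
  rcases p with ⟨c, _ | _⟩ <;> simp [Finsupp.single_apply, Pi.single_apply, eq_comm]

theorem eq_of_forall_next {α : Type*} (u : D.Passage → α) (h : ∀ p, u (D.next p) = u p)
    (p q : D.Passage) : u p = u q := by
  have key (k : ℕ) : u ((D.next ^ k) p) = u p := by
    induction k with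
    | zero => rfl
    | succ k ih => rw [pow_succ', Equiv.Perm.mul_apply, h, ih]
  obtain ⟨k, rfl⟩ := D.exists_pow_next p q
  exact (key k).symm

/-- `turn` inspects only the upper branch, but a cycle has even degree at each crossing, so going
straight on the upper branch forces the same on the lower one. The coefficient then never changes
along the single core circle. -/
theorem apply_eq_of_turn_eq_zero (z : LinearMap.ker D.boundary₁) (hz : D.turn z = 0)
    (p q : D.Passage) : z.1 p = z.1 q := by
  refine D.eq_of_forall_next z.1 (fun p => ?_) p q
  obtain ⟨q, rfl⟩ := D.next.symm.surjective p
  rw [Equiv.apply_symm_apply]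
  have h1 : z.1 (q.1, true) + z.1 (D.next.symm (q.1, true)) = 0 := congrFun hz q.1
  have h2 := D.boundary₁_apply z q.1
  rw [LinearMap.mem_ker.1 z.2, Finsupp.zero_apply] at h2
  have h3 : z.1 (q.1, false) + z.1 (D.next.symm (q.1, false)) = 0 := by
    linear_combination - h2 - h1
  rcases q with ⟨c, _ | _⟩
  · exact by linear_combination h3 - ZModModule.add_self (z.1 (D.next.symm (c, false)))
  · exact by linear_combination h1 - ZModModule.add_self (z.1 (D.next.symm (c, true)))

theorem knotCycle_apply (p : D.Passage) : D.knotCycle.1 p = 1 := by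
  simp [knotCycle, Finsupp.finsetSum_apply, Finsupp.single_apply]

theorem turn_knotCycle : D.turn D.knotCycle = 0 := by
  ext a
  rw [turn_apply, knotCycle_apply, knotCycle_apply]
  rfl

theorem mem_span_knotCycle (z : LinearMap.ker D.boundary₁) (hz : D.turn z = 0) :
    z ∈ Submodule.span (ZMod 2) {D.knotCycle} := by
  rw [Submodule.mem_span_singleton]
  rcases isEmpty_or_nonempty D.Passage with h | ⟨⟨p⟩⟩
  · exact ⟨0, Subtype.ext (Finsupp.ext fun p => h.elim p)⟩
  · refine ⟨z.1 p, Subtype.ext (Finsupp.ext fun q => ?_)⟩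
    rw [D.apply_eq_of_turn_eq_zero z hz q p]
    simp [knotCycle_apply]

/-! ### Faces -/

instance : Finite D.Face := Quotient.finite _

open Classical in
theorem faceChain_apply (F : D.Face) (p : D.Edge) : D.faceChain F p =
    (if D.face (p, true) = F then 1 else 0) + (if D.face (D.next p, false) = F then 1 else 0) := by
  have h (d : D.Dart) : (Finsupp.single (D.edge d) (1 : ZMod 2)) p =
      (if d = (p, true) then 1 else 0) + (if d = (D.next p, false) then 1 else 0) := by
    rcases d with ⟨q, _ | _⟩ <;> simp [edge, Finsupp.single_apply, Equiv.symm_apply_eq]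
  rw [faceChain, Finsupp.finsetSum_apply, Finset.sum_filter]
  simp only [h]
  rw [← Finset.sum_filter, Finset.sum_add_distrib]
  simp [Finset.sum_ite_eq']

theorem boundary₂_apply (c : D.Face →₀ ZMod 2) (p : D.Edge) :
    (D.boundary₂ c).1 p = c (D.face (p, true)) + c (D.face (D.next p, false)) := by
  classical
  induction c using Finsupp.induction_linear with
  | zero => simp
  | add f g hf hg =>
    rw [map_add, Submodule.coe_add, Finsupp.add_apply, hf, hg]; simp only [Finsupp.add_apply]; ring
  | single F r =>
    simp [boundary₂, faceChain_apply, Finsupp.single_apply, mul_add, eq_comm]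

theorem rot_symm_apply (p : D.Passage) (o : Bool) :
    D.rot.symm (p, o) = ((p.1, !p.2), xor o (xor (!p.2) (D.sign p.1))) := rfl

theorem rot_apply (p : D.Passage) (o : Bool) :
    D.rot (p, o) = ((p.1, !p.2), xor o (xor p.2 (D.sign p.1))) := rfl

theorem opp_true (p : D.Passage) : D.opp (p, true) = (D.next p, false) := rfl

theorem opp_false (p : D.Passage) : D.opp (p, false) = (D.next.symm p, true) := rfl

theorem opp_opp (d : D.Dart) : D.opp (D.opp d) = d := D.opp.left_inv d

theorem face_rot_symm (d : D.Dart) : D.face (D.rot.symm d) = D.face (D.opp d) := by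
  have := D.face_facePerm (D.opp d)
  rwa [facePerm, Equiv.trans_apply, opp_opp] at this

/-- A colouring of the half-edges that depends only on the face to the left. -/
def IsColouring {α : Type*} (c : D.Dart → α) : Prop := ∀ d, c (D.rot.symm d) = c (D.opp d)

/-- The sum of the colours of the corners at a crossing. -/
def cornerSum (c : D.Dart → ZMod 2) (a : D.Crossing) : ZMod 2 :=
  c ((a, true), true) + c ((a, true), false) + c ((a, false), true) + c ((a, false), false)

variable {D} in
theorem IsColouring.exists_face {α : Type*} {c : D.Dart → α} (hc : D.IsColouring c) :
    ∃ k : D.Face → α, ∀ d, k (D.face d) = c d := by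
  have h1 (d : D.Dart) : c (D.facePerm d) = c d := by
    rw [facePerm, Equiv.trans_apply, hc, opp_opp]
  have h2 (d : D.Dart) (i : ℕ) : c ((D.facePerm ^ i) d) = c d := by
    induction i with
    | zero => rfl
    | succ i ih => rw [pow_succ', Equiv.Perm.mul_apply, h1, ih]
  refine ⟨Quotient.lift c fun d e hde => ?_, fun d => rfl⟩
  obtain ⟨i, -, rfl⟩ := Equiv.Perm.SameCycle.exists_pow_eq' (hde : D.facePerm.SameCycle d e)
  exact (h2 d i).symm

theorem isColouring_face {α : Type*} (k : D.Face → α) : D.IsColouring fun d => k (D.face d) :=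
  fun d => congrArg k (D.face_rot_symm d)

/-- The combination of face boundaries, followed by `turn`. -/
def faceTurn : (D.Face →₀ ZMod 2) →ₗ[ZMod 2] (D.Crossing → ZMod 2) :=
  D.turn ∘ₗ (LinearMap.ker D.boundary₁).subtype ∘ₗ D.boundary₂

theorem faceTurn_eq_turn (k : D.Face →₀ ZMod 2) : D.faceTurn k = D.turn (D.boundary₂ k) := rfl

/-- The two sides of the two upper half-edges at a crossing are exactly its four corners. -/
theorem faceTurn_apply (k : D.Face →₀ ZMod 2) :
    D.faceTurn k = D.cornerSum fun d => k (D.face d) := by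
  ext a
  have h1 := D.face_rot_symm ((a, true), true)
  have h2 := D.face_rot_symm ((a, true), false)
  rw [faceTurn_eq_turn, turn_apply, boundary₂_apply, boundary₂_apply, Equiv.apply_symm_apply,
    cornerSum, ← opp_true, ← opp_false, ← h1, ← h2]
  simp only [rot_symm_apply]
  cases D.sign a <;> simp <;> ring

/-- The relations of the parity group, as a subspace. -/
def relSpace : Submodule (ZMod 2) (D.Crossing → ZMod 2) := LinearMap.range D.faceTurn

theorem mem_relSpace_iff (x : D.Crossing → ZMod 2) :
    x ∈ D.relSpace ↔ ∃ c, D.IsColouring c ∧ D.cornerSum c = x := by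
  constructor
  · rintro ⟨k, rfl⟩
    exact ⟨_, D.isColouring_face k, (D.faceTurn_apply k).symm⟩
  · rintro ⟨c, hc, rfl⟩
    obtain ⟨k, hk⟩ := hc.exists_face
    exact ⟨Finsupp.equivFunOnFinite.symm k, by simp [faceTurn_apply, hk]⟩

-- Identifies the images of the cells with the relators of the parity group, reduced mod 2.
open Classical in
theorem faceTurn_single (F : D.Face) : D.faceTurn (Finsupp.single F 1) =
    ∑ d : D.Dart with D.face d = F, Pi.single (vertex d) 1 := by
  rw [faceTurn_apply]
  ext a
  have h (c : D.Crossing) : ∑ i : Bool × Bool,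
      (if D.face ((c, i.1), i.2) = F then (Pi.single c 1 : D.Crossing → ZMod 2) a else 0) =
      if c = a then D.cornerSum (fun d => Finsupp.single F (1 : ZMod 2) (D.face d)) c else 0 := by
    split_ifs with hc
    · subst hc
      simp only [Fintype.sum_prod_type, Fintype.sum_bool, cornerSum, Finsupp.single_apply,
        Pi.single_eq_same, eq_comm (a := F), add_assoc]
    · simp [Ne.symm hc]
  rw [Finset.sum_apply, Finset.sum_filter, ← (Equiv.prodAssoc _ _ _).symm.sum_comp,
    Fintype.sum_prod_type]
  exact ((Finset.sum_congr rfl fun c _ => h c).trans (by simp)).symm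

end

section

variable (D : GaussDiagram)

/-! ### The parity group as a quotient of a vector space -/

instance : Module (ZMod 2) D.ParityGroup :=
  AddCommGroup.zmodModule (n := 2) fun x => by
    obtain ⟨x, rfl⟩ := QuotientAddGroup.mk_surjective x
    induction x using FreeAbelianGroup.induction_on with
    | zero => exact smul_zero 2
    | of a =>
      exact (QuotientAddGroup.eq_zero_iff _).2 (AddSubgroup.subset_closure (.inl ⟨a, rfl⟩))
    | neg a h => rw [QuotientAddGroup.mk_neg, smul_neg, h, neg_zero]
    | add x y hx hy => rw [QuotientAddGroup.mk_add, smul_add, hx, hy, add_zero]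

/-- The linear map to the parity group that sends basis vectors to generators. -/
def toParityGroup : (D.Crossing → ZMod 2) →ₗ[ZMod 2] D.ParityGroup :=
  Fintype.linearCombination (ZMod 2) D.gen

theorem toParityGroup_single (a : D.Crossing) : D.toParityGroup (Pi.single a 1) = D.gen a := by
  simp [toParityGroup, Fintype.linearCombination_apply_single]

theorem relSpace_le_ker : D.relSpace ≤ LinearMap.ker D.toParityGroup := by
  classical
  rintro _ ⟨k, rfl⟩
  rw [LinearMap.mem_ker, ← LinearMap.comp_apply]
  suffices h : D.toParityGroup ∘ₗ D.faceTurn = 0 by rw [h]; rfl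
  refine Finsupp.lhom_ext' fun F => LinearMap.ext_ring ?_
  simp only [LinearMap.comp_apply, Finsupp.lsingle_apply, LinearMap.zero_apply, faceTurn_single,
    map_sum, toParityGroup_single, gen]
  rw [← QuotientAddGroup.mk_sum]
  refine (QuotientAddGroup.eq_zero_iff _).2 (AddSubgroup.subset_closure (.inr ⟨F, ?_⟩))
  congr!

/-- The linear map from the parity group that sends generators to classes of basis vectors. -/
def ofParityGroup : D.ParityGroup →ₗ[ZMod 2] (D.Crossing → ZMod 2) ⧸ D.relSpace :=
  AddMonoidHom.toZModLinearMap 2 (QuotientAddGroup.lift _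
    (FreeAbelianGroup.lift fun a => D.relSpace.mkQ (Pi.single a 1)) (by
      classical
      rw [AddSubgroup.closure_le]
      rintro _ (⟨a, rfl⟩ | ⟨F, rfl⟩)
      · simp only [SetLike.mem_coe, AddMonoidHom.mem_ker, map_nsmul]
        exact ZModModule.char_nsmul_eq_zero 2 _
      · simp only [SetLike.mem_coe, AddMonoidHom.mem_ker, map_sum, FreeAbelianGroup.lift_apply_of]
        rw [← map_sum, Submodule.mkQ_apply, Submodule.Quotient.mk_eq_zero]
        refine ⟨Finsupp.single F 1, ?_⟩
        rw [faceTurn_single]))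

theorem ofParityGroup_gen (a : D.Crossing) :
    D.ofParityGroup (D.gen a) = D.relSpace.mkQ (Pi.single a 1) := by
  simp [ofParityGroup, gen]

/-- The parity group is the quotient of the space spanned by the crossings by the relations. -/
def parityGroupEquiv : D.ParityGroup ≃ₗ[ZMod 2] (D.Crossing → ZMod 2) ⧸ D.relSpace :=
  LinearEquiv.ofLinearMap D.ofParityGroup (D.relSpace.liftQ D.toParityGroup D.relSpace_le_ker)
    (by
      refine Submodule.linearMap_qext _ (LinearMap.pi_ext' fun a => LinearMap.ext_ring ?_)
      simp [toParityGroup_single, ofParityGroup_gen])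
    (by
      refine LinearMap.toAddMonoidHom_injective (QuotientAddGroup.addMonoidHom_ext _ ?_)
      refine FreeAbelianGroup.lift_ext _ _ fun a => ?_
      change D.relSpace.liftQ D.toParityGroup D.relSpace_le_ker (D.ofParityGroup (D.gen a)) = D.gen a
      rw [ofParityGroup_gen, Submodule.mkQ_apply, Submodule.liftQ_apply, toParityGroup_single])

theorem parityGroupEquiv_gen (a : D.Crossing) :
    D.parityGroupEquiv (D.gen a) = D.relSpace.mkQ (Pi.single a 1) :=
  D.ofParityGroup_gen a

/-! ### The parity group and homology -/

/-- The map from the homology group to the parity group that counts turns. -/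
def turnH₁ : D.H₁ →ₗ[ZMod 2] (D.Crossing → ZMod 2) ⧸ D.relSpace :=
  (LinearMap.range D.boundary₂).mapQ D.relSpace
    (D.turn ∘ₗ (LinearMap.ker D.boundary₁).subtype)
    (by rintro _ ⟨k, rfl⟩; exact ⟨k, rfl⟩)

theorem turnH₁_mk (z : LinearMap.ker D.boundary₁) :
    D.turnH₁ (Submodule.Quotient.mk z) = D.relSpace.mkQ (D.turn z) := rfl

theorem turnH₁_halfClass (p : D.Passage) :
    D.turnH₁ (D.halfClass p) = D.parityGroupEquiv (D.gen p.1) := by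
  rw [halfClass, turnH₁_mk, turn_halfCycle, parityGroupEquiv_gen]

theorem turnH₁_surjective : Function.Surjective D.turnH₁ := by
  intro y
  obtain ⟨x, rfl⟩ := D.relSpace.mkQ_surjective y
  refine ⟨∑ a, x a • D.halfClass (a, true), ?_⟩
  rw [map_sum]
  simp only [map_smul, turnH₁_halfClass, parityGroupEquiv_gen]
  simp only [← map_smul, ← map_sum]
  rw [← pi_eq_sum_univ']

theorem ker_turnH₁ : LinearMap.ker D.turnH₁ = Submodule.span (ZMod 2) {D.knotClass} := by
  apply le_antisymm
  · intro y hy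
    obtain ⟨z, rfl⟩ := (LinearMap.range D.boundary₂).mkQ_surjective y
    rw [LinearMap.mem_ker, Submodule.mkQ_apply, turnH₁_mk, Submodule.mkQ_apply,
      Submodule.Quotient.mk_eq_zero] at hy
    obtain ⟨k, hk⟩ := hy
    have h := D.mem_span_knotCycle (z - D.boundary₂ k)
      (by rw [Submodule.coe_sub, map_sub, ← hk, faceTurn_eq_turn, sub_self])
    rw [Submodule.mem_span_singleton] at h ⊢
    obtain ⟨r, hr⟩ := h
    refine ⟨r, ?_⟩
    rw [knotClass, ← Submodule.Quotient.mk_smul, hr, Submodule.mkQ_apply, Submodule.Quotient.eq]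
    exact ⟨-k, by rw [map_neg]; abel⟩
  · rw [Submodule.span_le, Set.singleton_subset_iff, SetLike.mem_coe, LinearMap.mem_ker, knotClass,
      turnH₁_mk, turn_knotCycle, map_zero]

theorem exists_equiv_quotient_knotClass :
    ∃ φ : D.ParityGroup ≃+ D.H₁ ⧸ Submodule.span (ZMod 2) {D.knotClass},
      ∀ p : D.Passage, φ (D.gen p.1) = Submodule.Quotient.mk (D.halfClass p) := by
  let e := (Submodule.quotEquivOfEq _ _ D.ker_turnH₁.symm).trans
    (D.turnH₁.quotKerEquivOfSurjective D.turnH₁_surjective)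
  refine ⟨(D.parityGroupEquiv.trans e.symm).toAddEquiv, fun p => ?_⟩
  refine (LinearEquiv.symm_apply_eq e).2 ?_
  exact (D.turnH₁_halfClass p).symm

theorem CheckerboardColourable.exists_boundary₂_eq {D : GaussDiagram}
    (h : D.CheckerboardColourable) : ∃ k, D.boundary₂ k = D.knotCycle := by
  obtain ⟨u, hu⟩ := h
  refine ⟨Finsupp.equivFunOnFinite.symm fun F => if u F then 1 else 0,
    Subtype.ext (Finsupp.ext fun p => ?_)⟩
  have := hu (p, true)
  rw [opp_true] at this
  rw [boundary₂_apply, knotCycle_apply]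
  simp only [Finsupp.equivFunOnFinite_symm_apply_apply]
  revert this
  cases u (D.face (p, true)) <;> cases u (D.face (D.next p, false)) <;> simp

theorem CheckerboardColourable.knotClass_eq_zero {D : GaussDiagram}
    (h : D.CheckerboardColourable) : D.knotClass = 0 := by
  rw [knotClass, Submodule.Quotient.mk_eq_zero]
  exact h.exists_boundary₂_eq

theorem exists_equiv_H₁ (h : D.CheckerboardColourable) :
    ∃ φ : D.ParityGroup ≃+ D.H₁, ∀ p : D.Passage, φ (D.gen p.1) = D.halfClass p := by
  have hker : LinearMap.ker D.turnH₁ = ⊥ := by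
    rw [ker_turnH₁, h.knotClass_eq_zero, Submodule.span_zero_singleton]
  let e := LinearEquiv.ofBijective D.turnH₁ ⟨LinearMap.ker_eq_bot.1 hker, D.turnH₁_surjective⟩
  refine ⟨(D.parityGroupEquiv.trans e.symm).toAddEquiv, fun p => ?_⟩
  exact (LinearEquiv.symm_apply_eq e).2 (D.turnH₁_halfClass p).symm

end

section

variable (D : GaussDiagram)

/-! ### Checkerboard colourability -/

theorem rot_symm_rot_symm (p : D.Passage) (o : Bool) :
    D.rot.symm (D.rot.symm (p, o)) = (p, !o) := by
  rcases p with ⟨c, _ | _⟩ <;> simp only [rot_symm_apply] <;> cases D.sign c <;> simp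

/-- Crossing an edge and rotating by one half-edge both flip the colour, so the incoming and the
outgoing half-edge of a passage have the same colour on their left. The colouring thus amounts to
one Boolean per passage. This form mentions neither cells nor signs, and is easily followed through
the moves. -/
theorem checkerboardColourable_iff : D.CheckerboardColourable ↔
    ∃ u : D.Passage → Bool, ∀ p, u (D.next p) = !u p ∧ u (p.1, !p.2) = !u p := by
  constructor
  · rintro ⟨κ, hκ⟩
    have h1 (d : D.Dart) : κ (D.face (D.opp d)) = !κ (D.face d) := by
      have := hκ d
      revert this
      cases κ (D.face d) <;> cases κ (D.face (D.opp d)) <;> simp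
    have h2 (d : D.Dart) : κ (D.face (D.rot.symm d)) = !κ (D.face d) := by
      rw [face_rot_symm, h1]
    have h3 (p : D.Passage) (o : Bool) : κ (D.face (p, o)) = κ (D.face (p, true)) := by
      cases o
      · rw [← Bool.not_true, ← rot_symm_rot_symm, h2, h2, Bool.not_not]
      · rfl
    refine ⟨fun p => κ (D.face (p, true)), fun p => ⟨?_, ?_⟩⟩
    · simp only
      rw [← h1, opp_true, h3 _ false]
    · simp only
      rw [← h2, rot_symm_apply, h3 _ (xor _ _)]
  · rintro ⟨u, hu⟩
    have h (d : D.Dart) : u (D.opp d).1 = !u d.1 := by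
      rcases d with ⟨p, _ | _⟩
      · rw [opp_false, ← Bool.not_not (u (D.next.symm p)), ← (hu _).1, Equiv.apply_symm_apply]
      · rw [opp_true, (hu _).1]
    have hc : D.IsColouring fun d => u d.1 := by
      rintro ⟨p, o⟩
      simp only
      rw [h, rot_symm_apply, (hu p).2]
    obtain ⟨k, hk⟩ := hc.exists_face
    refine ⟨k, fun d => ?_⟩
    rw [hk, hk, h]
    exact (Bool.not_ne_self _).symm

/-! ### The dimension of the parity group -/

theorem finrank_relSpace_add_finrank_ker :
    Module.finrank (ZMod 2) D.relSpace + Module.finrank (ZMod 2) (LinearMap.ker D.faceTurn) =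
      Nat.card D.Face := by
  have : Fintype D.Face := Fintype.ofFinite _
  rw [relSpace, LinearMap.finrank_range_add_finrank_ker, Module.finrank_finsupp_self,
    Nat.card_eq_fintype_card]

/-- Connectedness: the core circle runs along every cell, and the colour changes neither across an
edge nor around a crossing. -/
theorem eq_of_boundary₂_eq_zero (k : D.Face →₀ ZMod 2) (p : D.Passage)
    (h : ∀ q, (D.boundary₂ k).1 q = 0) (F : D.Face) : k F = k (D.face (p, true)) := by
  have h1 (q : D.Passage) : k (D.face (D.next q, false)) = k (D.face (q, true)) := by
    have := h q
    rw [boundary₂_apply] at this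
    linear_combination this - ZModModule.add_self (k (D.face (q, true)))
  have h2 (d : D.Dart) : k (D.face (D.rot.symm d)) = k (D.face d) := by
    rw [face_rot_symm]
    rcases d with ⟨q, _ | _⟩
    · rw [opp_false, ← h1, Equiv.apply_symm_apply]
    · rw [opp_true, h1]
  have h3 (q : D.Passage) (o : Bool) : k (D.face (q, o)) = k (D.face (q, true)) := by
    cases o
    · rw [← Bool.not_true, ← rot_symm_rot_symm, h2, h2]
    · rfl
  obtain ⟨⟨q, o⟩, rfl⟩ := Quotient.exists_rep F
  refine (h3 q o).trans (D.eq_of_forall_next (fun q => k (D.face (q, true))) (fun q => ?_) q p)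
  exact (h3 _ false).symm.trans (h1 q)

/-- The colour of a cell, and the change of the colour across an edge. -/
def evalKer (p : D.Passage) : LinearMap.ker D.faceTurn →ₗ[ZMod 2] ZMod 2 × ZMod 2 :=
  ((Finsupp.lapply (D.face (p, true))).prod
    (Finsupp.lapply p ∘ₗ (LinearMap.ker D.boundary₁).subtype ∘ₗ D.boundary₂)) ∘ₗ
      (LinearMap.ker D.faceTurn).subtype

theorem evalKer_apply (p : D.Passage) (k : LinearMap.ker D.faceTurn) :
    D.evalKer p k = (k.1 (D.face (p, true)), (D.boundary₂ k).1 p) := rfl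

theorem boundary₂_apply_eq (k : LinearMap.ker D.faceTurn) (p q : D.Passage) :
    (D.boundary₂ k).1 p = (D.boundary₂ k).1 q :=
  D.apply_eq_of_turn_eq_zero _ (LinearMap.mem_ker.1 k.2) p q

theorem evalKer_injective (p : D.Passage) : Function.Injective (D.evalKer p) := by
  rw [injective_iff_map_eq_zero]
  intro k hk
  rw [evalKer_apply, Prod.mk_eq_zero] at hk
  refine Subtype.ext (Finsupp.ext fun F => ?_)
  rw [D.eq_of_boundary₂_eq_zero k.1 p (fun q => (D.boundary₂_apply_eq k q p).trans hk.2), hk.1]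
  rfl

/-- Chains in the kernel bound zero or the knot, so they change by the same amount across every
edge. One colour and this change determine them; constants are always present, and change one occurs
exactly for checkerboard colourings. -/
theorem finrank_ker_le_two [Nonempty D.Crossing] :
    Module.finrank (ZMod 2) (LinearMap.ker D.faceTurn) ≤ 2 := by
  have p : D.Passage := (Classical.arbitrary _, true)
  simpa using LinearMap.finrank_le_finrank_of_injective (D.evalKer_injective p)

theorem finrank_ker_le_one [Nonempty D.Crossing] (h : ¬ D.CheckerboardColourable) :
    Module.finrank (ZMod 2) (LinearMap.ker D.faceTurn) ≤ 1 := by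
  have p : D.Passage := (Classical.arbitrary _, true)
  have h0 (k : LinearMap.ker D.faceTurn) : (D.boundary₂ k).1 p = 0 := by
    by_contra hk
    refine h ⟨fun F => decide (k.1 F = 0), ?_⟩
    have hne (q : D.Passage) :
        decide (k.1 (D.face (q, true)) = 0) ≠ decide (k.1 (D.face (D.next q, false)) = 0) := by
      rw [← D.boundary₂_apply_eq k q p, boundary₂_apply] at hk
      revert hk
      generalize k.1 (D.face (q, true)) = a
      generalize k.1 (D.face (D.next q, false)) = b
      revert a b
      decide
    rintro ⟨q, _ | _⟩
    · obtain ⟨q, rfl⟩ := D.next.surjective q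
      rw [opp_false, Equiv.symm_apply_apply]
      exact (hne q).symm
    · exact hne q
  have hinj : Function.Injective (LinearMap.fst (ZMod 2) (ZMod 2) (ZMod 2) ∘ₗ D.evalKer p) := by
    intro k l hkl
    refine D.evalKer_injective p (Prod.ext hkl ?_)
    rw [evalKer_apply, evalKer_apply, h0, h0]
  simpa using LinearMap.finrank_le_finrank_of_injective hinj

theorem exists_ker_eq_one :
    ∃ k : LinearMap.ker D.faceTurn, ∀ p, D.evalKer p k = (1, 0) := by
  have h : D.boundary₂ (Finsupp.equivFunOnFinite.symm fun _ => 1) = 0 := by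
    refine Subtype.ext (Finsupp.ext fun p => ?_)
    rw [boundary₂_apply]
    exact ZModModule.add_self (1 : ZMod 2)
  refine ⟨⟨Finsupp.equivFunOnFinite.symm fun _ => 1, ?_⟩, fun p => ?_⟩
  · rw [LinearMap.mem_ker, faceTurn_eq_turn, h]
    exact map_zero _
  · rw [evalKer_apply]
    simp only [h]
    rfl

theorem one_le_finrank_ker [Nonempty D.Crossing] :
    1 ≤ Module.finrank (ZMod 2) (LinearMap.ker D.faceTurn) := by
  have p : D.Passage := (Classical.arbitrary _, true)
  obtain ⟨k, hk⟩ := D.exists_ker_eq_one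
  refine Module.finrank_pos_iff_exists_ne_zero.2 ⟨k, fun h => ?_⟩
  have := hk p
  rw [h, map_zero] at this
  exact zero_ne_one (congrArg Prod.fst this)

theorem CheckerboardColourable.two_le_finrank_ker {D : GaussDiagram} [Nonempty D.Crossing]
    (h : D.CheckerboardColourable) :
    2 ≤ Module.finrank (ZMod 2) (LinearMap.ker D.faceTurn) := by
  have p : D.Passage := (Classical.arbitrary _, true)
  obtain ⟨k, hk⟩ := D.exists_ker_eq_one
  obtain ⟨l, hl⟩ := h.exists_boundary₂_eq
  have hl' : l ∈ LinearMap.ker D.faceTurn := by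
    rw [LinearMap.mem_ker, faceTurn_eq_turn, hl, turn_knotCycle]
  have hsurj : Function.Surjective (D.evalKer p) := by
    rintro ⟨r, s⟩
    -- `k` evaluates to `(1, 0)` and `l` to `(l (D.face (p, true)), 1)`; the first coefficient
    -- corrects the colour contributed by `l`.
    refine ⟨(r - s * l (D.face (p, true))) • k + s • ⟨l, hl'⟩, ?_⟩
    rw [map_add, map_smul, map_smul, hk, evalKer_apply, hl, knotCycle_apply]
    simp
  simpa using LinearMap.finrank_le_finrank_of_surjective hsurj

theorem eulerChar_eq [Nonempty D.Crossing] :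
    D.eulerChar = Nat.card D.Face - Nat.card D.Crossing := by
  have h : Nat.card D.Edge = Nat.card D.Crossing * 2 := by simp
  rw [eulerChar, if_neg (not_isEmpty_of_nonempty _), h]
  push_cast
  ring

/-- The dimension of the space of relations. -/
theorem finrank_relSpace_eq [Nonempty D.Crossing] : (Module.finrank (ZMod 2) D.relSpace : ℤ) =
    D.eulerChar + Nat.card D.Crossing - Module.finrank (ZMod 2) (LinearMap.ker D.faceTurn) := by
  rw [eulerChar_eq, ← finrank_relSpace_add_finrank_ker]
  push_cast
  ring

/-! ### Induced isomorphisms -/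

variable {D} {E : GaussDiagram}

/-- Both sides are dimensions of parity groups. For a diagram with crossings this is the dimension
of the kernel of `faceTurn` minus the Euler characteristic; the kernel has dimension two or one,
according to colourability. -/
theorem card_sub_finrank_le {g : ℕ} (hD : D.HasGenus g) (hE : E.HasGenus g)
    (hCB : E.CheckerboardColourable → D.CheckerboardColourable) :
    (Nat.card E.Crossing : ℤ) - Module.finrank (ZMod 2) E.relSpace ≤
      Nat.card D.Crossing - Module.finrank (ZMod 2) D.relSpace := by
  have hχ : D.eulerChar = E.eulerChar := Eq.trans hD (Eq.symm hE)
  have hle : Module.finrank (ZMod 2) D.relSpace ≤ Nat.card D.Crossing := by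
    simpa using D.relSpace.finrank_le
  rcases isEmpty_or_nonempty E.Crossing with hE0 | hE0
  · have h0 : Nat.card E.Crossing = 0 := Nat.card_of_isEmpty
    omega
  have h1 := E.finrank_relSpace_eq
  have h2 := E.finrank_ker_le_two
  rcases isEmpty_or_nonempty D.Crossing with hD0 | hD0
  · have h3 : D.eulerChar = 2 := if_pos hD0
    omega
  · have h3 := D.finrank_relSpace_eq
    have h4 := D.one_le_finrank_ker
    by_cases hc : E.CheckerboardColourable
    · have := (hCB hc).two_le_finrank_ker
      omega
    · have := E.finrank_ker_le_one hc
      omega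

/-- The map between spaces spanned by crossings that is induced by a map of crossings. -/
def crossingMap (f : D.Crossing → E.Crossing) :
    (D.Crossing → ZMod 2) →ₗ[ZMod 2] (E.Crossing → ZMod 2) :=
  Fintype.linearCombination (ZMod 2) fun a => Pi.single (f a) 1

theorem crossingMap_single (f : D.Crossing → E.Crossing) (a : D.Crossing) :
    crossingMap f (Pi.single a 1) = Pi.single (f a) 1 := by
  simp [crossingMap, Fintype.linearCombination_apply_single]

theorem crossingMap_apply {f : D.Crossing → E.Crossing} (hf : Function.Injective f)
    (x : D.Crossing → ZMod 2) (a : D.Crossing) : crossingMap f x (f a) = x a := by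
  simp [crossingMap, Fintype.linearCombination_apply, Pi.single_apply, hf.eq_iff]

theorem crossingMap_apply_of_notMem {f : D.Crossing → E.Crossing} {b : E.Crossing}
    (hb : b ∉ Set.range f) (x : D.Crossing → ZMod 2) : crossingMap f x b = 0 := by
  have h (a : D.Crossing) : b ≠ f a := fun h => hb ⟨a, h.symm⟩
  simp [crossingMap, Fintype.linearCombination_apply, h]

/-- The map from the crossings of `D` to the parity group of `E` has kernel inside the relations of
`D`, so its rank is at least the dimension of the group of `D`. That is at least the dimension of
its target, so all the inequalities are equalities. -/
theorem exists_equiv_of_comap_le {g : ℕ} (hD : D.HasGenus g) (hE : E.HasGenus g)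
    (hCB : E.CheckerboardColourable → D.CheckerboardColourable) (f : D.Crossing → E.Crossing)
    (h : E.relSpace.comap (crossingMap f) ≤ D.relSpace) :
    ∃ φ : D.ParityGroup ≃+ E.ParityGroup, ∀ x, φ (D.gen x) = E.gen (f x) := by
  let q := E.relSpace.mkQ ∘ₗ crossingMap f
  have hq : LinearMap.ker q = E.relSpace.comap (crossingMap f) := by
    rw [LinearMap.ker_comp, Submodule.ker_mkQ]
  have h1 := card_sub_finrank_le hD hE hCB
  have h2 := q.finrank_range_add_finrank_ker
  have h3 := (LinearMap.range q).finrank_le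
  have h4 := E.relSpace.finrank_quotient_add_finrank
  have h5 : Module.finrank (ZMod 2) (LinearMap.ker q) ≤ Module.finrank (ZMod 2) D.relSpace :=
    Submodule.finrank_mono (hq.trans_le h)
  rw [Module.finrank_fintype_fun_eq_card, ← Nat.card_eq_fintype_card] at h2 h4
  have hker : LinearMap.ker q = D.relSpace :=
    Submodule.eq_of_le_of_finrank_eq (hq.trans_le h) (by omega)
  have hsurj : Function.Surjective q :=
    LinearMap.range_eq_top.1 (Submodule.eq_top_of_finrank_eq (by omega))
  let e := (Submodule.quotEquivOfEq _ _ hker.symm).trans (q.quotKerEquivOfSurjective hsurj)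
  refine ⟨((D.parityGroupEquiv.trans e).trans E.parityGroupEquiv.symm).toAddEquiv, fun x => ?_⟩
  refine (LinearEquiv.symm_apply_eq E.parityGroupEquiv).2 ?_
  rw [parityGroupEquiv_gen]
  change e (D.parityGroupEquiv (D.gen x)) = _
  rw [parityGroupEquiv_gen]
  change E.relSpace.mkQ (crossingMap f (Pi.single x 1)) = _
  rw [crossingMap_single]

end

section

variable {D E : GaussDiagram}

/-! ### Deletion of chords -/

/-- The deleted passages fall into disjoint pairs of adjacent passages; `B` is the set of the
first passages of the pairs. -/
structure IsBlocks (E : GaussDiagram) (S : Set E.Crossing) (B : Set E.Passage) : Prop where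
  notMem_iff : ∀ u : E.Passage, u.1 ∉ S ↔ u ∈ B ∨ E.next.symm u ∈ B
  next_notMem : ∀ u ∈ B, E.next u ∉ B

/-- `Λ` labels edges by their first passage. The label is unchanged when a whole deleted pair is
skipped, so the first and the last of the edges of `E` that merge into one edge of `D` have equal
labels. -/
theorem IsDeletion.apply_next {f : D.Crossing → E.Crossing} {B : Set E.Passage}
    (h : IsDeletion D E f) (hB : IsBlocks E (Set.range f) B) {α : Type*} (Λ : E.Passage → α)
    (hΛ : ∀ u ∈ B, Λ (E.next.symm u) = Λ (E.next u)) (p : D.Passage) :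
    Λ (E.next.symm (f (D.next p).1, (D.next p).2)) = Λ (f p.1, p.2) := by
  obtain ⟨k, hk0, hk, hdel⟩ := h.next_eq p
  rw [← hk]
  generalize hq : ((f p.1, p.2) : E.Passage) = q at *
  have hq0 : q.1 ∈ Set.range f := by rw [← hq]; exact ⟨_, rfl⟩
  have hsucc (n : ℕ) : (E.next ^ (n + 1)) q = E.next ((E.next ^ n) q) := by
    rw [pow_succ', Equiv.Perm.mul_apply]
  have hsymm (n : ℕ) : E.next.symm ((E.next ^ (n + 1)) q) = (E.next ^ n) q := by
    rw [hsucc, Equiv.symm_apply_apply]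
  have key (j : ℕ) (hj : 2 * j + 1 ≤ k) : Λ ((E.next ^ (2 * j)) q) = Λ q ∧
      (2 * j + 1 < k → (E.next ^ (2 * j + 1)) q ∈ B) := by
    induction j with
    | zero =>
      refine ⟨rfl, fun hlt => ?_⟩
      refine ((hB.notMem_iff _).1 (hdel _ (by omega) hlt)).resolve_right fun hmem => ?_
      rw [hsymm] at hmem
      exact (hB.notMem_iff q).2 (.inl hmem) hq0
    | succ j ih =>
      obtain ⟨ih1, ih2⟩ := ih (by omega)
      have hu := ih2 (by omega)
      have hu' := hΛ _ hu
      rw [hsymm, ← hsucc, ih1] at hu'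
      refine ⟨hu'.symm, fun hlt => ?_⟩
      refine ((hB.notMem_iff _).1 (hdel _ (by omega) hlt)).resolve_right fun hmem => ?_
      rw [hsymm] at hmem
      refine hB.next_notMem _ hu ?_
      rwa [← hsucc]
  obtain ⟨j, rfl | rfl⟩ : ∃ j, k = 2 * j + 1 ∨ k = 2 * j + 1 + 1 := ⟨(k - 1) / 2, by omega⟩
  · rw [hsymm]
    exact (key j le_rfl).1
  -- An even number of steps would make the surviving passage the second member of a deleted pair.
  · have := (key j (by omega)).2 (by omega)
    rw [← hsymm] at this
    refine absurd ?_ ((hB.notMem_iff _).2 (.inr this))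
    rw [hk]
    exact ⟨_, rfl⟩

theorem IsDeletion.checkerboardColourable {f : D.Crossing → E.Crossing} {B : Set E.Passage}
    (h : IsDeletion D E f) (hB : IsBlocks E (Set.range f) B) (hE : E.CheckerboardColourable) :
    D.CheckerboardColourable := by
  rw [checkerboardColourable_iff] at hE ⊢
  obtain ⟨u, hu⟩ := hE
  have hpred (p : E.Passage) : u p = !u (E.next.symm p) := by
    rw [← (hu _).1, Equiv.apply_symm_apply]
  refine ⟨fun p => u (f p.1, p.2), fun p => ⟨?_, (hu (f p.1, p.2)).2⟩⟩
  simp only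
  rw [hpred, h.apply_next hB u]
  intro v _
  rw [(hu v).1, hpred v, Bool.not_not]

/-- The colours agree across every pair of deleted adjacent passages. -/
def IsColouring.Extends (c : E.Dart → ZMod 2) (B : Set E.Passage) : Prop :=
  ∀ u ∈ B, c (E.rot.symm (u, false)) = c (E.next u, true) ∧
    c (u, false) = c (E.rot.symm (E.next u, true))

theorem cornerSum_comp {f : D.Crossing → E.Crossing} (c : E.Dart → ZMod 2) (a : D.Crossing) :
    D.cornerSum (fun d => c ((f d.1.1, d.1.2), d.2)) a = E.cornerSum c (f a) := rfl

theorem IsDeletion.isColouring {f : D.Crossing → E.Crossing} {B : Set E.Passage}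
    (h : IsDeletion D E f) (hB : IsBlocks E (Set.range f) B) {c : E.Dart → ZMod 2}
    (hc : E.IsColouring c) (hcB : IsColouring.Extends c B) :
    D.IsColouring fun d => c ((f d.1.1, d.1.2), d.2) := by
  -- The label of an edge is the pair of colours on its left and on its right.
  have key := h.apply_next hB (fun q => (c (q, true), c (E.next q, false))) (by
    intro u hu
    obtain ⟨h1, h2⟩ := hcB u hu
    rw [hc, opp_false] at h1
    rw [hc, opp_true] at h2
    simp only [Equiv.apply_symm_apply, h1, h2])
  simp only [Equiv.apply_symm_apply, Prod.mk.injEq] at key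
  rintro ⟨p, o⟩
  have h1 : c (E.rot.symm ((f p.1, p.2), o)) = c (E.opp ((f p.1, p.2), o)) := hc _
  rw [rot_symm_apply] at h1 ⊢
  simp only [h.sign_eq] at h1 ⊢
  rw [h1]
  cases o
  · obtain ⟨q, rfl⟩ := D.next.surjective p
    simp only [opp_false, Equiv.symm_apply_apply]
    exact (key q).1
  · exact (key p).2.symm

theorem IsDeletion.comap_le {f : D.Crossing → E.Crossing} {B : Set E.Passage}
    (h : IsDeletion D E f) (hB : IsBlocks E (Set.range f) B)
    (hcB : ∀ c, E.IsColouring c → (∀ a ∉ Set.range f, E.cornerSum c a = 0) →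
      IsColouring.Extends c B) :
    E.relSpace.comap (crossingMap f) ≤ D.relSpace := by
  intro x hx
  rw [Submodule.mem_comap, mem_relSpace_iff] at hx
  obtain ⟨c, hc, hx⟩ := hx
  rw [mem_relSpace_iff]
  refine ⟨_, h.isColouring hB hc (hcB c hc fun a ha => ?_), ?_⟩
  · rw [hx, crossingMap_apply_of_notMem ha]
  · ext a
    rw [cornerSum_comp, hx, crossingMap_apply h.injective]

/-! ### The pairs of passages deleted by each move -/

theorem isBlocks_empty {S : Set E.Crossing} (hS : S = Set.univ) : IsBlocks E S ∅ := by
  subst hS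
  exact ⟨by simp, by simp⟩

theorem isBlocks_reidemeister₁ {S : Set E.Crossing} {a : E.Crossing} (hS : S = {a}ᶜ) {l : Bool}
    (hl : E.next (a, l) = (a, !l)) : IsBlocks E S {(a, l)} := by
  subst hS
  constructor
  · rintro ⟨c, m⟩
    simp only [Set.mem_compl_iff, Set.mem_singleton_iff, not_not, Equiv.symm_apply_eq, hl,
      Prod.mk.injEq, ← and_or_left]
    cases l <;> cases m <;> simp
  · simp [hl]

/-- The two corners beside the monogon lie in one cell, the one across the loop edge, so the colours
agree without any condition on corner sums. -/
theorem extends_reidemeister₁ {a : E.Crossing} {l : Bool} (hl : E.next (a, l) = (a, !l))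
    {c : E.Dart → ZMod 2} (hc : E.IsColouring c) : IsColouring.Extends c {(a, l)} := by
  rintro _ rfl
  have h1 := hc ((a, l), true)
  have h2 := hc ((a, !l), false)
  rw [opp_true, hl] at h1
  rw [opp_false, ← hl, Equiv.symm_apply_apply, hl] at h2
  rw [hl]
  simp only [rot_symm_apply] at *
  cases l <;> cases hs : E.sign a <;> simp_all

theorem isBlocks_reidemeister₂ {S : Set E.Crossing} {a b x y : E.Crossing} (hab : a ≠ b)
    (hS : S = {a, b}ᶜ) (ho : E.next (a, true) = (b, true))
    (hxy : x = a ∧ y = b ∨ x = b ∧ y = a) (hu : E.next (x, false) = (y, false)) :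
    IsBlocks E S {(a, true), (x, false)} := by
  subst hS
  constructor
  · rintro ⟨c, m⟩
    simp only [Set.mem_compl_iff, Set.mem_insert_iff, Set.mem_singleton_iff, not_not,
      Equiv.symm_apply_eq, ho, hu, Prod.mk.injEq]
    rcases hxy with ⟨rfl, rfl⟩ | ⟨rfl, rfl⟩ <;> cases m <;> simp [or_comm]
  · rcases hxy with ⟨rfl, rfl⟩ | ⟨rfl, rfl⟩ <;> simp [ho, hu, hab, hab.symm]

-- Two of the cells around the bigon touch both crossings and continue past it. The corner of `a`
-- opposite the bigon has, as the corner sum at `a` vanishes, the sum of the colours of the bigon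
-- and those two cells; the same holds at `b`, so the two cells that the inverse move merges have
-- equal colours.
set_option linter.unusedSimpArgs false in
theorem extends_reidemeister₂ {a b x y : E.Crossing} (hs : E.sign a ≠ E.sign b)
    (ho : E.next (a, true) = (b, true))
    (hxy : x = a ∧ y = b ∨ x = b ∧ y = a) (hu : E.next (x, false) = (y, false))
    {c : E.Dart → ZMod 2} (hc : E.IsColouring c)
    (ha : E.cornerSum c a = 0) (hb : E.cornerSum c b = 0) :
    IsColouring.Extends c {(a, true), (x, false)} := by
  have h1 := hc ((a, true), true)
  have h2 := hc ((b, true), false)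
  have h3 := hc ((x, false), true)
  have h4 := hc ((y, false), false)
  rw [opp_true, ho] at h1
  rw [opp_false, ← ho, Equiv.symm_apply_apply, ho] at h2
  rw [opp_true, hu] at h3
  rw [opp_false, ← hu, Equiv.symm_apply_apply, hu] at h4
  have hs' : E.sign b = !E.sign a := by
    revert hs; cases E.sign a <;> cases E.sign b <;> simp
  cases hsa : E.sign a <;> rw [hsa] at hs' <;> rcases hxy with ⟨rfl, rfl⟩ | ⟨rfl, rfl⟩ <;>
    rintro _ (rfl | rfl) <;> simp only [ho, hu] <;>
    simp only [rot_symm_apply, cornerSum, hs', hsa, Bool.not_true, Bool.not_false, Bool.xor_true,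
      Bool.xor_false, Bool.true_xor, Bool.false_xor] at * <;> grind

end

section

variable {D E : GaussDiagram}

/-! ### The third Reidemeister move -/

theorem rot_rot (d : D.Dart) : D.rot (D.rot d) = (d.1, !d.2) := by
  rcases d with ⟨⟨c, _ | _⟩, _ | _⟩ <;> simp only [rot_apply] <;> cases D.sign c <;> simp

theorem rot_symm_eq (d : D.Dart) : D.rot.symm d = D.rot (D.rot (D.rot d)) := by
  rw [Equiv.symm_apply_eq, rot_rot, rot_rot]
  simp

theorem rot_ne (d : D.Dart) : D.rot d ≠ d := by
  rcases d with ⟨⟨c, _ | _⟩, _ | _⟩ <;> simp [rot_apply]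

theorem rot_rot_ne (d : D.Dart) : D.rot (D.rot d) ≠ d := by
  rw [rot_rot]
  rcases d with ⟨⟨c, _ | _⟩, _ | _⟩ <;> simp

theorem vertex_rot (d : D.Dart) : vertex (D.rot d) = vertex d := rfl

theorem cornerSum_vertex (c : D.Dart → ZMod 2) (d : D.Dart) : D.cornerSum c (vertex d) =
    c d + c (D.rot d) + c (D.rot (D.rot d)) + c (D.rot (D.rot (D.rot d))) := by
  rw [rot_rot d]
  rcases d with ⟨⟨x, _ | _⟩, _ | _⟩ <;> simp only [rot_apply, cornerSum, vertex] <;>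
    cases D.sign x <;> simp <;> ring

theorem eq_of_vertex_eq {d e : D.Dart} (h : vertex e = vertex d) :
    e = d ∨ e = D.rot d ∨ e = D.rot (D.rot d) ∨ e = D.rot (D.rot (D.rot d)) := by
  rw [rot_rot d]
  rcases d with ⟨⟨x, l⟩, o⟩
  rcases e with ⟨⟨y, m⟩, n⟩
  obtain rfl : y = x := h
  simp only [rot_apply]
  cases D.sign y <;> revert l m n o <;> simp

/-- A triangular cell with the half-edges `d i` in its boundary, and a map `T` of half-edges that
moves each side of the triangle across the opposite crossing. -/
structure IsTriangle (D : GaussDiagram) (d : Fin 3 → D.Dart) (T : D.Dart → D.Dart) : Prop where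
  vertex_injective : Function.Injective fun i => vertex (d i)
  rot_succ : ∀ i, D.rot (d (i + 1)) = D.opp (d i)
  map_dart : ∀ i, T (d i) = D.rot (D.rot (D.opp (d i)))
  map_opp : ∀ i, T (D.opp (d i)) = D.rot (D.rot (d i))
  map_rot : ∀ i, T (D.rot (D.rot (d i))) = D.opp (d i)
  map_rot_opp : ∀ i, T (D.rot (D.rot (D.opp (d i)))) = d i
  map_eq : ∀ e, (∀ i, vertex e ≠ vertex (d i)) → T e = e

namespace IsTriangle

variable {d : Fin 3 → D.Dart} {T : D.Dart → D.Dart}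

theorem rot_eq (h : IsTriangle D d T) (i : Fin 3) : D.rot (d i) = D.opp (d (i + 2)) := by
  have h0 : i + 2 + 1 = i := by clear h; revert i; decide
  rw [← h.rot_succ, h0]

open Classical in
/-- The colouring of the half-edges before the move, made from the colouring `c` after the
move; the triangle gets the colour `q`. -/
def recolour (D : GaussDiagram) (d : Fin 3 → D.Dart) (c : D.Dart → ZMod 2) (q : ZMod 2)
    (e : D.Dart) : ZMod 2 :=
  -- For `c` as in `exists_isColouring`, the half-edges `D.rot (d i)` carry the colour of the
  -- triangle after the move. The colour of the outer cell at that corner is therefore read from the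
  -- other end of the next half-edge, which leads away from the triangle.
  if ∃ i, e = d i then q else if ∃ i, e = D.rot (d i) then c (D.opp (D.rot e)) else c e

variable (c : D.Dart → ZMod 2) (q : ZMod 2)

theorem recolour_dart (i : Fin 3) : recolour D d c q (d i) = q := if_pos ⟨i, rfl⟩

theorem rot_dart_ne (h : IsTriangle D d T) (i j : Fin 3) : D.rot (d i) ≠ d j := by
  intro he
  obtain rfl : i = j := h.vertex_injective (congrArg vertex he :)
  exact rot_ne _ he

theorem recolour_rot (h : IsTriangle D d T) (i : Fin 3) :
    recolour D d c q (D.rot (d i)) = c (D.opp (D.rot (D.rot (d i)))) := by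
  rw [recolour, if_neg (fun ⟨j, hj⟩ => h.rot_dart_ne i j hj), if_pos ⟨i, rfl⟩]

theorem recolour_rot_rot (h : IsTriangle D d T) (i : Fin 3) :
    recolour D d c q (D.rot (D.rot (d i))) = c (D.rot (D.rot (d i))) := by
  rw [recolour, if_neg, if_neg]
  · rintro ⟨j, hj⟩
    obtain rfl : i = j := h.vertex_injective (congrArg vertex hj :)
    exact rot_ne _ hj
  · rintro ⟨j, hj⟩
    obtain rfl : i = j := h.vertex_injective (congrArg vertex hj :)
    exact rot_rot_ne _ hj

theorem recolour_rot_rot_rot (h : IsTriangle D d T) (i : Fin 3) :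
    recolour D d c q (D.rot (D.rot (D.rot (d i)))) = c (D.rot (D.rot (D.rot (d i)))) := by
  rw [recolour, if_neg, if_neg]
  · rintro ⟨j, hj⟩
    obtain rfl : i = j := h.vertex_injective (congrArg vertex hj :)
    exact rot_rot_ne _ hj
  · rintro ⟨j, hj⟩
    obtain rfl : i = j := h.vertex_injective (congrArg vertex hj :)
    rw [← rot_symm_eq, Equiv.symm_apply_eq] at hj
    exact rot_ne _ hj.symm

theorem recolour_opp (h : IsTriangle D d T) (e : D.Dart) (h0 : ∀ i, e ≠ d i)
    (h1 : ∀ i, e ≠ D.rot (d i)) : recolour D d c q (D.opp e) = c (D.opp e) := by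
  rw [recolour, if_neg, if_neg]
  · rintro ⟨j, hj⟩
    rw [h.rot_eq, EmbeddingLike.apply_eq_iff_eq] at hj
    exact h0 _ hj
  · rintro ⟨j, hj⟩
    refine h1 (j + 1) ?_
    rw [h.rot_succ, ← hj, opp_opp]

theorem recolour_of_vertex_ne (e : D.Dart) (he : ∀ i, vertex e ≠ vertex (d i)) :
    recolour D d c q e = c e := by
  rw [recolour, if_neg, if_neg]
  · rintro ⟨j, rfl⟩
    exact he j rfl
  · rintro ⟨j, rfl⟩
    exact he j rfl

variable {c}

/-- A colouring after the third Reidemeister move gives a colouring before it with the same sums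
of corners. -/
theorem exists_isColouring (h : IsTriangle D d T)
    (hc : ∀ e, c (T (D.rot.symm (T e))) = c (D.opp e)) :
    ∃ k, D.IsColouring k ∧ D.cornerSum k = D.cornerSum (c ∘ T) := by
  have e21 (i : Fin 3) : i + 2 + 1 = i := by revert i; decide
  have e12 (i : Fin 3) : i + 1 + 2 = i := by revert i; decide
  have e11 (i : Fin 3) : i + 1 + 1 = i + 2 := by revert i; decide
  have e22 (i : Fin 3) : i + 2 + 2 = i + 1 := by revert i; decide
  have t0 (i : Fin 3) : T (d i) = D.rot (D.rot (D.rot (d (i + 1)))) := by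
    rw [h.map_dart, h.rot_succ]
  have t1 (i : Fin 3) : T (D.rot (d i)) = D.rot (D.rot (d (i + 2))) := by
    rw [h.rot_eq, h.map_opp]
  have t3 (i : Fin 3) : T (D.rot (D.rot (D.rot (d i)))) = d (i + 2) := by
    rw [h.rot_eq, h.map_rot_opp]
  -- `h1` to `h4` are the colouring condition at the twelve half-edges around the triangle; `h4`
  -- says that the corners of the new triangle have one colour.
  have h1 (i : Fin 3) : c (d i) = c (D.opp (D.rot (D.rot (D.rot (d (i + 2)))))) := by
    have := hc (D.rot (D.rot (D.rot (d (i + 2)))))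
    rwa [t3, rot_symm_eq, t3, e22 i, e12] at this
  have h2 (i : Fin 3) : c (D.rot (D.rot (D.rot (d (i + 1))))) =
      c (D.opp (D.rot (D.rot (d (i + 2))))) := by
    have := hc (D.rot (D.rot (d (i + 2))))
    rwa [h.map_rot, ← h.rot_succ, e21, Equiv.symm_apply_apply, t0] at this
  have h3 (i : Fin 3) : c (D.rot (D.rot (d i))) = c (d (i + 1)) := by
    have := hc (D.opp (d (i + 1)))
    rwa [h.map_opp, Equiv.symm_apply_apply, t1, e12, opp_opp] at this
  have h4 (i : Fin 3) : c (D.opp (d (i + 1))) = c (D.opp (d i)) := by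
    have := hc (d i)
    rwa [t0, Equiv.symm_apply_apply, h.map_rot] at this
  -- Before the move a corner sum contains the triangle and three consecutive cells of the six
  -- around it; afterwards it contains the new triangle and the other three. So the sums agree at
  -- all three crossings if `q` is the colour of the new triangle plus those of all six outer cells.
  let q := c (D.opp (d 0)) + ∑ i, (c (D.rot (D.rot (d i))) + c (D.rot (D.rot (D.rot (d i)))))
  have hrr (i : Fin 3) : recolour D d c q (D.opp (D.rot (D.rot (d i)))) =
      c (D.opp (D.rot (D.rot (d i)))) := by
    refine recolour_opp c q h _ (fun j hj => ?_) (fun j hj => ?_) <;>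
      obtain rfl : i = j := h.vertex_injective (congrArg vertex hj :)
    · exact rot_rot_ne _ hj
    · exact rot_ne _ hj
  have hrrr (i : Fin 3) : recolour D d c q (D.opp (D.rot (D.rot (D.rot (d i))))) =
      c (D.opp (D.rot (D.rot (D.rot (d i))))) := by
    refine recolour_opp c q h _ (fun j hj => ?_) (fun j hj => ?_) <;>
      obtain rfl : i = j := h.vertex_injective (congrArg vertex hj :)
    · rw [← rot_symm_eq, Equiv.symm_apply_eq] at hj
      exact rot_ne _ hj.symm
    · exact rot_rot_ne _ hj
  refine ⟨recolour D d c q, fun e => ?_, funext fun a => ?_⟩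
  · by_cases he : ∃ i, vertex e = vertex (d i)
    · obtain ⟨i, hi⟩ := he
      rcases eq_of_vertex_eq hi with rfl | rfl | rfl | rfl
      · rw [rot_symm_eq, recolour_rot_rot_rot c q h, ← h.rot_succ, recolour_rot c q h]
        have := h2 (i + 2)
        rwa [e21, e22] at this
      · rw [Equiv.symm_apply_apply, recolour_dart, h.rot_eq, opp_opp, recolour_dart]
      · rw [Equiv.symm_apply_apply, recolour_rot c q h, hrr]
      · rw [Equiv.symm_apply_apply, recolour_rot_rot c q h, hrrr, h3, h1, e12]
    · push Not at he
      have := hc e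
      rw [h.map_eq e he, h.map_eq (D.rot.symm e) he] at this
      rw [recolour_of_vertex_ne c q (D.rot.symm e) he, this, recolour_opp c q h]
      · rintro j rfl
        exact he j rfl
      · rintro j rfl
        exact he j rfl
  · by_cases ha : ∃ i, a = vertex (d i)
    · obtain ⟨i, rfl⟩ := ha
      rw [cornerSum_vertex, cornerSum_vertex]
      simp only [Function.comp_apply, t0, t1, t3, h.map_rot]
      rw [recolour_dart, recolour_rot c q h, recolour_rot_rot c q h, recolour_rot_rot_rot c q h]
      have h2' := h2 (i + 1)
      have h3' := h3 (i + 1)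
      rw [e11, e12] at h2'
      rw [e11] at h3'
      rw [← h2', ← h3']
      have hq : q = c (D.opp (d i)) +
          (c (D.rot (D.rot (d i))) + c (D.rot (D.rot (D.rot (d i)))) +
          (c (D.rot (D.rot (d (i + 1)))) + c (D.rot (D.rot (D.rot (d (i + 1)))))) +
          (c (D.rot (D.rot (d (i + 2)))) + c (D.rot (D.rot (D.rot (d (i + 2))))))) := by
        have h40 := h4 0
        have h41 := h4 1
        simp only [q, Fin.sum_univ_three]
        fin_cases i <;> simp at * <;> grind
      rw [hq]
      grind
    · push Not at ha
      obtain ⟨e, rfl⟩ : ∃ e : D.Dart, vertex e = a := ⟨((a, true), true), rfl⟩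
      rw [cornerSum_vertex, cornerSum_vertex]
      simp only [Function.comp_apply]
      rw [recolour_of_vertex_ne c q e ha, recolour_of_vertex_ne c q (D.rot e) ha,
        recolour_of_vertex_ne c q (D.rot (D.rot e)) ha,
        recolour_of_vertex_ne c q (D.rot (D.rot (D.rot e))) ha, h.map_eq e ha,
        h.map_eq (D.rot e) ha, h.map_eq (D.rot (D.rot e)) ha,
        h.map_eq (D.rot (D.rot (D.rot e))) ha]

end IsTriangle

end

/-! ### Swapping the ends of the sides of the triangle -/

section

variable {D E : GaussDiagram}

/-- The permutation `τ` exchanges the two ends of each of the edges in `S`, which are the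
passages through the crossings in `X`. -/
structure IsEdgeSwap (D : GaussDiagram) (S : Set D.Edge) (X : Finset D.Crossing)
    (τ : Equiv.Perm D.Passage) : Prop where
  apply_edge : ∀ s ∈ S, τ s = D.next s
  apply_next : ∀ s ∈ S, τ (D.next s) = s
  fst_ne : ∀ s ∈ S, s.1 ≠ (D.next s).1
  fst_mem : ∀ s ∈ S, s.1 ∈ X
  next_fst_mem : ∀ s ∈ S, (D.next s).1 ∈ X
  exists_edge : ∀ p : D.Passage, p.1 ∈ X → ∃ s ∈ S, p = s ∨ p = D.next s
  apply_eq : ∀ p : D.Passage, p.1 ∉ X → τ p = p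

theorem isEdgeSwap_of_triangle {x y z : D.Crossing} (hxy : x ≠ y) (hxz : x ≠ z) (hyz : y ≠ z)
    {t m b : D.Edge} (ht : s(t, D.next t) = s((x, true), (y, true)))
    (hm : s(m, D.next m) = s((x, false), (z, true)))
    (hb : s(b, D.next b) = s((y, false), (z, false))) :
    IsEdgeSwap D {t, m, b} {x, y, z} (Equiv.swap (x, true) (y, true) *
      Equiv.swap (x, false) (z, true) * Equiv.swap (y, false) (z, false)) := by
  generalize hτ : Equiv.swap (x, true) (y, true) * Equiv.swap (x, false) (z, true) *
    Equiv.swap (y, false) (z, false) = τ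
  have h (p : D.Passage) : τ p = Equiv.swap (x, true) (y, true)
      (Equiv.swap (x, false) (z, true) (Equiv.swap (y, false) (z, false) p)) := by
    rw [← hτ]; rfl
  have h1 : τ (x, true) = (y, true) := by simp [h, Equiv.swap_apply_def, hxz]
  have h2 : τ (y, true) = (x, true) := by simp [h, Equiv.swap_apply_def, hyz]
  have h3 : τ (x, false) = (z, true) := by
    simp [h, Equiv.swap_apply_def, hxy, hxz, hxz.symm, hyz.symm]
  have h4 : τ (z, true) = (x, false) := by simp [h, Equiv.swap_apply_def]
  have h5 : τ (y, false) = (z, false) := by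
    simp [h, Equiv.swap_apply_def, hxz.symm]
  have h6 : τ (z, false) = (y, false) := by
    simp [h, Equiv.swap_apply_def, hxy.symm]
  have h7 (p : D.Passage) (hp : p.1 ∉ ({x, y, z} : Finset D.Crossing)) : τ p = p := by
    simp only [Finset.mem_insert, Finset.mem_singleton, not_or] at hp
    obtain ⟨c, l⟩ := p
    simp only at hp
    rw [h, Equiv.swap_apply_of_ne_of_ne (a := (y, false)),
      Equiv.swap_apply_of_ne_of_ne (a := (x, false)), Equiv.swap_apply_of_ne_of_ne] <;>
      simp [hp]
  clear h hτ
  rw [Sym2.eq_iff] at ht hm hb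
  refine ⟨?_, ?_, ?_, ?_, ?_, ?_, h7⟩ <;> clear h7
  · rintro s (rfl | rfl | rfl) <;> grind only
  · rintro s (rfl | rfl | rfl) <;> grind only
  · rintro s (rfl | rfl | rfl) <;> grind
  · rintro s (rfl | rfl | rfl) <;> rw [Finset.mem_insert, Finset.mem_insert, Finset.mem_singleton] <;>
      grind
  · rintro s (rfl | rfl | rfl) <;> rw [Finset.mem_insert, Finset.mem_insert, Finset.mem_singleton] <;>
      grind
  · rintro ⟨c, l⟩ hp
    simp only [Finset.mem_insert, Finset.mem_singleton] at hp
    simp only [Set.mem_insert_iff, Set.mem_singleton_iff, exists_eq_or_imp, exists_eq_left]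
    cases l <;> rcases hp with rfl | rfl | rfl <;> grind only

namespace IsEdgeSwap

variable {S : Set D.Edge} {X : Finset D.Crossing} {τ : Equiv.Perm D.Passage}

theorem apply_apply (h : IsEdgeSwap D S X τ) (p : D.Passage) : τ (τ p) = p := by
  by_cases hp : p.1 ∈ X
  · obtain ⟨s, hs, rfl | rfl⟩ := h.exists_edge p hp
    · rw [h.apply_edge _ hs, h.apply_next _ hs]
    · rw [h.apply_next _ hs, h.apply_edge _ hs]
  · rw [h.apply_eq p hp, h.apply_eq p hp]

theorem edge_opp (e : D.Dart) : D.edge (D.opp e) = D.edge e := by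
  rcases e with ⟨p, _ | _⟩ <;> simp [opp_true, opp_false, edge]

theorem map_dart (h : IsEdgeSwap D S X τ) (e : D.Dart) (he : D.edge e ∈ S) :
    (τ e.1, e.2) = D.rot (D.rot (D.opp e)) := by
  rcases e with ⟨p, _ | _⟩
  · obtain ⟨s, rfl⟩ := D.next.surjective p
    have hs : s ∈ S := by simpa [edge] using he
    rw [opp_false, rot_rot, h.apply_next s hs]
    simp
  · rw [opp_true, rot_rot, h.apply_edge p he]
    rfl

theorem vertex_ne (h : IsEdgeSwap D S X τ) (e : D.Dart) (he : D.edge e ∈ S) :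
    vertex (D.opp e) ≠ vertex e := by
  rcases e with ⟨p, _ | _⟩
  · obtain ⟨s, rfl⟩ := D.next.surjective p
    have hs : s ∈ S := by simpa [edge] using he
    rw [opp_false, Equiv.symm_apply_apply]
    exact h.fst_ne s hs
  · exact (h.fst_ne p he).symm

theorem vertex_mem (h : IsEdgeSwap D S X τ) (e : D.Dart) (he : D.edge e ∈ S) :
    vertex e ∈ X := by
  rcases e with ⟨p, _ | _⟩
  · obtain ⟨s, rfl⟩ := D.next.surjective p
    exact h.next_fst_mem s (by simpa [edge] using he)
  · exact h.fst_mem p he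

/-- Consecutive corners are distinct since each side joins different crossings, and among three
indices any two different ones are consecutive. -/
theorem isTriangle (h : IsEdgeSwap D S X τ) (hX : X.card ≤ 3) (d : Fin 3 → D.Dart)
    (hd : ∀ i, D.facePerm (d i) = d (i + 1)) (hS : ∀ i, D.edge (d i) ∈ S) :
    IsTriangle D d fun e => (τ e.1, e.2) := by
  have hrot (i : Fin 3) : D.rot (d (i + 1)) = D.opp (d i) := by
    rw [← hd, facePerm, Equiv.trans_apply, Equiv.apply_symm_apply]
  have hS' (i : Fin 3) : D.edge (D.opp (d i)) ∈ S := by rw [edge_opp]; exact hS i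
  have hrr (e : D.Dart) : (τ (D.rot (D.rot e)).1, (D.rot (D.rot e)).2) =
      D.rot (D.rot (τ e.1, e.2)) := by rw [rot_rot, rot_rot]
  have h4 (e : D.Dart) : D.rot (D.rot (D.rot (D.rot e))) = e := by
    rw [rot_rot, rot_rot]; simp
  have hinj : Function.Injective fun i => vertex (d i) := by
    have hne (i : Fin 3) : vertex (d (i + 1)) ≠ vertex (d i) := by
      rw [← vertex_rot, hrot]
      exact h.vertex_ne _ (hS i)
    have hcases (i j : Fin 3) : i = j ∨ i = j + 1 ∨ j = i + 1 := by
      clear hne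
      revert i j; decide
    intro i j hij
    rcases hcases i j with hc | rfl | rfl
    · exact hc
    · exact absurd hij (hne j)
    · exact absurd hij.symm (hne i)
  refine ⟨hinj, hrot, fun i => h.map_dart _ (hS i), fun i => ?_, fun i => ?_, fun i => ?_,
    fun e he => ?_⟩
  · rw [h.map_dart _ (hS' i), opp_opp]
  · rw [hrr, h.map_dart _ (hS i), h4]
  · rw [hrr, h.map_dart _ (hS' i), opp_opp, h4]
  -- Three distinct vertices exhaust `X`, so `τ` fixes all passages through other crossings.
  · have hsub : Finset.univ.image (fun i => vertex (d i)) = X := by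
      refine Finset.eq_of_subset_of_card_le ?_ ?_
      · intro a ha
        obtain ⟨i, -, rfl⟩ := Finset.mem_image.1 ha
        exact h.vertex_mem _ (hS i)
      · rwa [Finset.card_image_of_injective _ hinj, Finset.card_univ, Fintype.card_fin]
    have : e.1.1 ∉ X := by
      rw [← hsub, Finset.mem_image]
      rintro ⟨i, -, hi⟩
      exact he i hi.symm
    rw [h.apply_eq _ this]

/-- At the crossings of the triangle, `τ` replaces each passage by a neighbour and so flips its
Boolean. Both passages of a crossing are flipped, so they still differ. -/
theorem checkerboardColourable (h : IsEdgeSwap D S X τ) {f : D.Crossing → E.Crossing}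
    (hn : ∀ p : D.Passage,
      E.next (f (τ p).1, (τ p).2) = (f (τ (D.next p)).1, (τ (D.next p)).2))
    (hE : E.CheckerboardColourable) : D.CheckerboardColourable := by
  rw [checkerboardColourable_iff] at hE ⊢
  obtain ⟨u, hu⟩ := hE
  have hnext (p : D.Passage) :
      u (f (τ (D.next p)).1, (τ (D.next p)).2) = !u (f (τ p).1, (τ p).2) := by
    rw [← hn, (hu _).1]
  have hmem (p : D.Passage) (hp : p.1 ∈ X) :
      u (f (τ p).1, (τ p).2) = !u (f p.1, p.2) := by
    obtain ⟨s, hs, rfl | rfl⟩ := h.exists_edge p hp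
    · have := hnext p
      rw [h.apply_next _ hs, h.apply_edge _ hs] at this
      rw [h.apply_edge _ hs, this, Bool.not_not]
    · have := hnext s
      rw [h.apply_next _ hs, h.apply_edge _ hs] at this
      rw [h.apply_next _ hs, this]
  refine ⟨fun p => u (f (τ p).1, (τ p).2), fun p => ⟨hnext p, ?_⟩⟩
  simp only
  by_cases hp : p.1 ∈ X
  · rw [hmem p hp, hmem (p.1, !p.2) hp, (hu (f p.1, p.2)).2]
  · rw [h.apply_eq p hp, h.apply_eq (p.1, !p.2) hp, (hu (f p.1, p.2)).2]

/-- Transported by `f` and `τ`, a colouring of `E` satisfies the colouring condition with the edges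
of `D` but with the rotation conjugated by `τ`, as `exists_isColouring` requires. -/
theorem comap_le (h : IsEdgeSwap D S X τ) {d : Fin 3 → D.Dart}
    (hd : IsTriangle D d fun e => (τ e.1, e.2)) {f : D.Crossing → E.Crossing}
    (hf : Function.Injective f) (hs : ∀ c, E.sign (f c) = D.sign c)
    (hn : ∀ p : D.Passage,
      E.next (f (τ p).1, (τ p).2) = (f (τ (D.next p)).1, (τ (D.next p)).2)) :
    E.relSpace.comap (crossingMap f) ≤ D.relSpace := by
  intro x hx
  rw [Submodule.mem_comap, mem_relSpace_iff] at hx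
  obtain ⟨c, hc, hx⟩ := hx
  obtain ⟨k, hk, hkx⟩ := hd.exists_isColouring
    (c := fun e => c ((f (τ e.1).1, (τ e.1).2), e.2)) (by
      rintro ⟨p, o⟩
      have h1 : c (E.rot.symm ((f (τ p).1, (τ p).2), o)) = c (E.opp ((f (τ p).1, (τ p).2), o)) :=
        hc _
      simp only [rot_symm_apply, hs, h.apply_apply] at h1 ⊢
      rw [h1]
      cases o
      · obtain ⟨q, rfl⟩ := D.next.surjective p
        rw [opp_false, opp_false, ← hn, Equiv.symm_apply_apply, Equiv.symm_apply_apply]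
      · rw [opp_true, opp_true, hn])
  rw [mem_relSpace_iff]
  refine ⟨k, hk, hkx.trans (funext fun a => ?_)⟩
  rw [← crossingMap_apply hf x a, ← hx]
  simp only [cornerSum, Function.comp_apply, h.apply_apply]

end IsEdgeSwap

/-! ### Invariance -/

theorem Move.exists_equiv {f : D.Crossing → E.Crossing} (hm : Move D E f) {g : ℕ}
    (hD : D.HasGenus g) (hE : E.HasGenus g) :
    ∃ φ : D.ParityGroup ≃+ E.ParityGroup, ∀ x, φ (D.gen x) = E.gen (f x) := by
  cases hm with
  | iso h hf =>
    have hB : IsBlocks E (Set.range f) ∅ := isBlocks_empty hf.range_eq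
    exact exists_equiv_of_comap_le hD hE (h.checkerboardColourable hB) f
      (h.comap_le hB fun _ _ _ _ hu => hu.elim)
  | reidemeister₁ h a ha l hl =>
    have hB := isBlocks_reidemeister₁ ha hl
    exact exists_equiv_of_comap_le hD hE (h.checkerboardColourable hB) f
      (h.comap_le hB fun c hc _ => extends_reidemeister₁ hl hc)
  | reidemeister₂ h a b hab hr hs ho hu =>
    obtain ⟨x, y, hxy, hu⟩ : ∃ x y, (x = a ∧ y = b ∨ x = b ∧ y = a) ∧
        E.next (x, false) = (y, false) := by
      rcases hu with hu | hu
      · exact ⟨a, b, .inl ⟨rfl, rfl⟩, hu⟩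
      · exact ⟨b, a, .inr ⟨rfl, rfl⟩, hu⟩
    have hB := isBlocks_reidemeister₂ hab hr ho hxy hu
    refine exists_equiv_of_comap_le hD hE (h.checkerboardColourable hB) f
      (h.comap_le hB fun c hc h0 => extends_reidemeister₂ hs ho hxy hu hc (h0 a ?_) (h0 b ?_)) <;>
    simp [hr]
  | reidemeister₃ x y z hxy hxz hyz t m b ht hm hb d hd hd' hf hs τ hτ hn =>
    have hswap := isEdgeSwap_of_triangle hxy hxz hyz ht hm hb
    rw [← hτ] at hswap
    have htri := hswap.isTriangle Finset.card_le_three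
      ![d, D.facePerm d, D.facePerm (D.facePerm d)]
      (by intro i; fin_cases i <;> simp [hd])
      (by rw [← hd']; intro i; fin_cases i <;> simp)
    exact exists_equiv_of_comap_le hD hE (hswap.checkerboardColourable hn) f
      (hswap.comap_le htri hf.injective hs hn)

theorem NonstablyEquivalent.exists_equiv {g : ℕ} {R : D.Crossing → E.Crossing → Prop}
    (h : NonstablyEquivalent g D E R) : E.HasGenus g ∧
      ∃ φ : D.ParityGroup ≃+ E.ParityGroup, ∀ x y, R x y → φ (D.gen x) = E.gen y := by
  induction h with
  | refl h => exact ⟨h, AddEquiv.refl _, by rintro x _ rfl; rfl⟩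
  | move f h hm hF ih =>
    obtain ⟨hE, φ, hφ⟩ := ih
    obtain ⟨ψ, hψ⟩ := hm.exists_equiv hE hF
    refine ⟨hF, φ.trans ψ, ?_⟩
    rintro x _ ⟨y, hxy, rfl⟩
    rw [AddEquiv.trans_apply, hφ x y hxy, hψ]
  | moveInv f h hm hF ih =>
    obtain ⟨hE, φ, hφ⟩ := ih
    obtain ⟨ψ, hψ⟩ := hm.exists_equiv hF hE
    refine ⟨hF, φ.trans ψ.symm, fun x z hxz => ?_⟩
    rw [AddEquiv.trans_apply, hφ x (f z) hxz, ← hψ, AddEquiv.symm_apply_apply]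

end

end GaussDiagram

end

/-! ### The main theorem -/

theorem mainTheorem6 :
    (∀ D : GaussDiagram,
      (∃ φ : D.ParityGroup ≃+ D.H₁ ⧸ Submodule.span (ZMod 2) {D.knotClass},
        ∀ p : D.Passage, φ (D.gen p.1) = Submodule.Quotient.mk (D.halfClass p)) ∧
      (D.CheckerboardColourable →
        ∃ φ : D.ParityGroup ≃+ D.H₁, ∀ p : D.Passage, φ (D.gen p.1) = D.halfClass p)) ∧
    (∀ (g : ℕ) (D₁ D₂ : GaussDiagram) (R : D₁.Crossing → D₂.Crossing → Prop),
      GaussDiagram.NonstablyEquivalent g D₁ D₂ R →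
        ∃ φ : D₁.ParityGroup ≃+ D₂.ParityGroup,
          ∀ x y, R x y → φ (D₁.gen x) = D₂.gen y) :=
  ⟨fun D => ⟨D.exists_equiv_quotient_knotClass, D.exists_equiv_H₁⟩,
    fun _ _ _ _ h => h.exists_equiv.2⟩
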